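/- Let $F$ be a finitary set functor (an endofunctor of $\mathbf{Set}$ preserving filtered colimits) and let $X$ be a nonempty set. Then $F$ has a presentation, i.e. a finitary signature $\Sigma=(\Sigma_n)_{n\in\mathbb N}$ and a natural transformation $\varepsilon\colon H_\Sigma\to F$ with surjective components, where $H_\Sigma Z=\coprod_{n}\Sigma_n\times Z^n$; and a free $F$-algebra $(\Phi X,\varphi,\eta_\Phi)$ on $X$ and a free completely iterative $F$-algebra $(\Psi X,\psi,\eta_\Psi)$ on $X$ exist. (An algebra $\alpha\colon FA\to A$ is completely iterative if for every set $Y$ and every $e\colon Y\to FY+A$ there is a unique $s\colon Y\to A$ with $s=[\alpha,\mathrm{id}]\cdot(Fs+\mathrm{id})\cdot e$.) Fix any presentation and any $p\in\Sigma_0+X$. For a (finite or infinite) $\Sigma$-tree $t$ over $X$ let $\partial_n t$ be the tree obtained by deleting all nodes of height greater than $n$ and then relabelling all leaves of height $n$ by $p$. Let $\sim$ be the congruence on the algebra of finite $\Sigma$-trees over $X$ generated by the substitution instances of $\varepsilon$-equations (equations $\sigma(x_1,\dots,x_n)=\tau(y_1,\dots,y_m)$ between flat terms over a set $Z$ that are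 merged by $\varepsilon_Z$), and for arbitrary trees put $s\sim^* t$ iff $\partial_n s\sim\partial_n t$ for all $n$. Then $\Phi X$ is the quotient of the algebra of finite $\Sigma$-trees over $X$ modulo $\sim$, and $\Psi X$ is the quotient of the algebra of all $\Sigma$-trees over $X$ modulo $\sim^*$. Both are posets when ordered by cutting: for distinct classes, $[s]<[t]$ iff $s\sim\partial_n t$ (respectively $s\sim^*\partial_n t$) for some $n\in\mathbb N$. The homomorphism $m\colon\Phi X\to\Psi X$ with $m\cdot\eta_\Phi=\eta_\Psi$ is an order embedding, so that $\Phi X$ is regarded as a subposet of $\Psi X$. A cpo is a poset in which all (nonempty) directed subsets have joins; a map of posets is continuous if it preserves all existing directed joins; a conservative completion of a poset $P$ is a cpo $C$ with a continuous order embedding $P\to C$ such that every continuous map from $P$ to a cpo has a unique continuous extension to $C$. Then: 1. $\Phi X$ and $\Psi X$ have the same conservative completion: there are a cpo $C$ and a map $j\colon\Psi X\to C$ such that $j$ is a conservative completion of $\Psi X$ and $j\cdot m$ is a conservative completion of $\Phi X$. 2. The algebra structure of $\Psi X$ is the unique continuous extension of that of $\Phi X$: the maps $[\varphi,\eta_\Phi]\colon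 F(\Phi X)+X\to\Phi X$ and $[\psi,\eta_\Psi]\colon F(\Psi X)+X\to\Psi X$ are bijective and, with $F(\Psi X)+X$ ordered via the bijection $[\psi,\eta_\Psi]$, the map $[\psi,\eta_\Psi]$ is the unique continuous $h\colon F(\Psi X)+X\to\Psi X$ with $h\cdot(Fm+\mathrm{id}_X)=m\cdot[\varphi,\eta_\Phi]$. Likewise, with $F(\Psi X)$ ordered via the injection $\psi$, the map $\psi$ is the unique continuous $h\colon F(\Psi X)\to\Psi X$ with $h\cdot Fm=m\cdot\varphi$. -/

import Mathlib

open CategoryTheory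

universe u

namespace SetFunctor

/-! ### Signatures, polynomial functors and presentations -/

/-- A finitary signature: a set of operation symbols of every arity `n : ℕ`. -/
structure Signature where
  /-- the set of `n`-ary operation symbols -/
  Op : ℕ → Type u

/-- The polynomial functor `H_Σ X = ∐ n, Σ_n × X ^ n`; its elements are flat terms
`σ(x₁, …, xₙ)`. -/
def polynomialFunctor (S : Signature.{u}) : Type u ⥤ Type u where
  obj X := Σ n : ℕ, S.Op n × (Fin n → X)
  map f := TypeCat.ofHom fun t => ⟨t.1, t.2.1, fun i => f (t.2.2 i)⟩

/-- The flat term `σ(x₁, …, xₙ)`. -/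
def flat {S : Signature.{u}} {X : Type u} {n : ℕ} (σ : S.Op n) (x : Fin n → X) :
    (polynomialFunctor S).obj X :=
  ⟨n, σ, x⟩

/-- A presentation of a set functor: a finitary signature together with a natural transformation
`ε : H_Σ ⟶ F` all of whose components are surjective. -/
structure Presentation (F : Type u ⥤ Type u) where
  /-- the signature -/
  sig : Signature.{u}
  /-- the natural transformation -/
  ε : polynomialFunctor sig ⟶ F
  surjective : ∀ X : Type u, Function.Surjective (ε.app X)

/-! ### Finite and arbitrary `Σ`-trees over `X`, and cutting -/

/-- Finite `Σ`-trees over `X`, that is, terms in variables from `X`. -/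
inductive FinTree (S : Signature.{u}) (X : Type u) : Type u
  | var (x : X) : FinTree S X
  | app {n : ℕ} (σ : S.Op n) (t : Fin n → FinTree S X) : FinTree S X

/-- Node types of `Σ`-trees over `X`: a node labelled by an `n`-ary symbol has `n` children,
a node labelled by a variable has none. -/
def nodeShape (S : Signature.{u}) (X : Type u) : PFunctor.{u, 0} where
  A := (Σ n : ℕ, S.Op n) ⊕ X
  B a := match a with
    | Sum.inl σ => Fin σ.1
    | Sum.inr _ => Empty

/-- All (finite and infinite) `Σ`-trees over `X`. -/
def Tree (S : Signature.{u}) (X : Type u) : Type u := (nodeShape S X).M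

namespace Tree

variable {S : Signature.{u}} {X : Type u}

/-- The root-only tree labelled by the variable `x`. -/
def var (x : X) : Tree S X :=
  PFunctor.M.mk (F := nodeShape S X) ⟨Sum.inr x, fun i : Empty => i.elim⟩

/-- Tree tupling: the tree with root label `σ` and maximum proper subtrees `t₁, …, tₙ`. -/
def app {n : ℕ} (σ : S.Op n) (t : Fin n → Tree S X) : Tree S X :=
  PFunctor.M.mk (F := nodeShape S X) ⟨Sum.inl ⟨n, σ⟩, t⟩

end Tree

/-- The inclusion of the finite `Σ`-trees into all `Σ`-trees. -/
def FinTree.toTree {S : Signature.{u}} {X : Type u} : FinTree S X → Tree S X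
  | .var x => Tree.var x
  | .app σ t => Tree.app σ fun i => (t i).toTree

/-- The root-only tree labelled by a chosen `p ∈ Σ₀ + X`. -/
def pointTree {S : Signature.{u}} {X : Type u} : S.Op 0 ⊕ X → FinTree S X
  | Sum.inl c => .app c fun i => i.elim0
  | Sum.inr x => .var x

/-- The cutting `∂ₙ t` of a tree at height `n`: all nodes of height larger than `n` are removed,
and all leaves of height `n` (of the resulting tree) are relabelled by `p`. -/
def cut {S : Signature.{u}} {X : Type u} (p : S.Op 0 ⊕ X) : ℕ → Tree S X → FinTree S X
  | 0, _ => pointTree p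
  | n + 1, t => match PFunctor.M.dest (F := nodeShape S X) t with
    | ⟨Sum.inl σ, f⟩ => .app σ.2 fun i => cut p n (f i)
    | ⟨Sum.inr x, _⟩ => .var x

/-! ### The congruences `∼` and `∼*` -/

/-- The congruence `∼` on finite `Σ`-trees over `X`, generated by all substitution instances of
`ε`-equations. An `ε`-equation is an equation `σ(x₁, …, xₙ) = τ(y₁, …, yₘ)` between flat terms
over a set `Z` of variables that are merged by the component of `ε` at `Z`. -/
inductive Sim {F : Type u ⥤ Type u} (P : Presentation F) {X : Type u} :
    FinTree P.sig X → FinTree P.sig X → Prop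
  | equation {Z : Type u} {n m : ℕ} (σ : P.sig.Op n) (τ : P.sig.Op m) (x : Fin n → Z)
      (y : Fin m → Z) (h : P.ε.app Z (flat σ x) = P.ε.app Z (flat τ y))
      (f : Z → FinTree P.sig X) :
      Sim P (.app σ fun i => f (x i)) (.app τ fun j => f (y j))
  | congr {n : ℕ} (σ : P.sig.Op n) (s t : Fin n → FinTree P.sig X) (h : ∀ i, Sim P (s i) (t i)) :
      Sim P (.app σ s) (.app σ t)
  | refl (s : FinTree P.sig X) : Sim P s s
  | symm {s t : FinTree P.sig X} (h : Sim P s t) : Sim P t s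
  | trans {s t r : FinTree P.sig X} (h : Sim P s t) (h' : Sim P t r) : Sim P s r

/-- The congruence `∼*` on all `Σ`-trees over `X`: a possibly infinite application of
`ε`-equations, that is, `s ∼* t` iff `∂ₙ s ∼ ∂ₙ t` for all `n`. -/
def SimStar {F : Type u ⥤ Type u} (P : Presentation F) {X : Type u} (p : P.sig.Op 0 ⊕ X)
    (s t : Tree P.sig X) : Prop :=
  ∀ n : ℕ, Sim P (cut p n s) (cut p n t)

/-! ### Free algebras and free completely iterative algebras -/

section Algebras

variable {F : Type u ⥤ Type u}

/-- `A` is a free `F`-algebra on `X` with respect to `η`. -/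
def IsFreeAlgebra {X : Type u} (A : Endofunctor.Algebra F) (η : X → A.a) : Prop :=
  ∀ (B : Endofunctor.Algebra F) (f : X → B.a), ∃! h : A ⟶ B, ∀ x, h.f (η x) = f x

/-- `s` solves the recursive equation `e : Y → F Y + A`, that is,
`s = [α, id] ∘ (F s + id) ∘ e`. -/
def IsSolution (A : Endofunctor.Algebra F) {Y : Type u} (e : Y → F.obj Y ⊕ A.a)
    (s : Y → A.a) : Prop :=
  ∀ y, s y = Sum.elim (fun t => A.str (F.map (TypeCat.ofHom s) t)) id (e y)

/-- Every recursive equation in `A` has a unique solution. -/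
def IsCompletelyIterative (A : Endofunctor.Algebra F) : Prop :=
  ∀ (Y : Type u) (e : Y → F.obj Y ⊕ A.a), ∃! s : Y → A.a, IsSolution A e s

/-- `A` is a free completely iterative `F`-algebra on `X` with respect to `η`. -/
structure IsFreeCompletelyIterative {X : Type u} (A : Endofunctor.Algebra F) (η : X → A.a) :
    Prop where
  completelyIterative : IsCompletelyIterative A
  universal : ∀ (B : Endofunctor.Algebra F), IsCompletelyIterative B →
    ∀ f : X → B.a, ∃! h : A ⟶ B, ∀ x, h.f (η x) = f x

/-- `q` exhibits the algebra `A` with `η : X → A` as the quotient of the algebra of finite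
`Σ`-trees over `X` modulo `∼`. -/
structure IsFinTreeQuotient (P : Presentation F) {X : Type u} (A : Endofunctor.Algebra F)
    (η : X → A.a) (q : FinTree P.sig X → A.a) : Prop where
  map_var : ∀ x, q (.var x) = η x
  map_app : ∀ {n : ℕ} (σ : P.sig.Op n) (t : Fin n → FinTree P.sig X),
    q (.app σ t) = A.str (P.ε.app A.a (flat σ fun i => q (t i)))
  surjective : Function.Surjective q
  eq_iff : ∀ s t, q s = q t ↔ Sim P s t

/-- `k` exhibits the algebra `A` with `η : X → A` as the quotient of the algebra of all
`Σ`-trees over `X` modulo `∼*`. -/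
structure IsTreeQuotient (P : Presentation F) {X : Type u} (p : P.sig.Op 0 ⊕ X)
    (A : Endofunctor.Algebra F) (η : X → A.a) (k : Tree P.sig X → A.a) : Prop where
  map_var : ∀ x, k (Tree.var x) = η x
  map_app : ∀ {n : ℕ} (σ : P.sig.Op n) (t : Fin n → Tree P.sig X),
    k (Tree.app σ t) = A.str (P.ε.app A.a (flat σ fun i => k (t i)))
  surjective : Function.Surjective k
  eq_iff : ∀ s t, k s = k t ↔ SimStar P p s t

end Algebras

/-! ### Orders by cutting -/

/-- The order by cutting on a quotient `q` of the finite trees modulo `∼`: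
for distinct classes, `[s] < [t]` iff `s ∼ ∂ₙ t` for some `n`. -/
def IsFinCuttingOrder {F : Type u ⥤ Type u} (P : Presentation F) {X : Type u}
    (p : P.sig.Op 0 ⊕ X) {A : Type u} [PartialOrder A] (q : FinTree P.sig X → A) : Prop :=
  ∀ s t : FinTree P.sig X, q s ≤ q t ↔ (q s = q t ∨ ∃ n : ℕ, Sim P s (cut p n t.toTree))

/-- The order by cutting on a quotient `k` of all trees modulo `∼*`:
for distinct classes, `[s] < [t]` iff `s ∼* ∂ₙ t` for some `n`. -/
def IsCuttingOrder {F : Type u ⥤ Type u} (P : Presentation F) {X : Type u}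
    (p : P.sig.Op 0 ⊕ X) {A : Type u} [PartialOrder A] (k : Tree P.sig X → A) : Prop :=
  ∀ s t : Tree P.sig X, k s ≤ k t ↔ (k s = k t ∨ ∃ n : ℕ, SimStar P p s (cut p n t).toTree)

/-! ### Cpos and conservative completions -/

/-- A cpo: a poset in which every (nonempty) directed subset has a join. -/
def IsCpo (Q : Type u) [PartialOrder Q] : Prop :=
  ∀ d : Set Q, d.Nonempty → DirectedOn (· ≤ ·) d → ∃ b, IsLUB d b

/-- `j : P → C` is a conservative completion of the poset `P`: `C` is a cpo, `j` is an embedding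
of a subposet closed under existing directed joins, and every continuous function from `P` to a
cpo has a unique continuous extension to `C`. Continuity, `ScottContinuous`, is the preservation
of all existing (nonempty) directed joins. -/
structure IsConservativeCompletion {P C : Type u} [PartialOrder P] [PartialOrder C]
    (j : P → C) : Prop where
  isCpo : IsCpo C
  le_iff_le : ∀ x y, j x ≤ j y ↔ x ≤ y
  continuous : ScottContinuous j
  universal : ∀ (Q : Type u) [PartialOrder Q], IsCpo Q → ∀ f : P → Q, ScottContinuous f →
    ∃! g : C → Q, ScottContinuous g ∧ ∀ x, g (j x) = f x

/-- For the structure maps `a : S → A` and `b : T → B`, a map `i : S → T` and a map `m : A → B`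
(the last two regarded as inclusions): `b` is the unique continuous extension of `a`,
where `T` carries the order that makes `b` an order embedding. -/
structure IsUniqueContinuousExtension {S T A B : Type u} [PartialOrder B]
    (a : S → A) (b : T → B) (i : S → T) (m : A → B) : Prop where
  continuous : @ScottContinuous T B (Preorder.lift b) _ b
  extends_base : ∀ x, b (i x) = m (a x)
  unique : ∀ h : T → B, @ScottContinuous T B (Preorder.lift b) _ h →
    (∀ x, h (i x) = m (a x)) → h = b

end SetFunctor

/-!
The proof compares the trees with their cuttings.

*Algebra.* Finite trees modulo `∼` and arbitrary trees modulo `∼*` become `F`-algebras by computing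
the structure with chosen flat terms and chosen representatives (`quotientAlgebra`). Evaluation of
terms shows that the first is free (`IsFinTreeQuotient.isFreeAlgebra`). In the second, a recursive
equation is solved by unfolding it to trees, and the solution is unique because its cuttings at
height `n` are determined by induction on `n`
(`IsTreeQuotient.isCompletelyIterative`). Freeness needs that `[ψ, η]` is bijective
(`IsTreeQuotient.bijective`), and this is where finiteness of the arities enters: finitely many
classes modulo `∼*` are distinguished by their cuttings at a single height, so that an equation that
holds for the cuttings at this height can be transported back along a map on classes
(`IsTreeQuotient.ε_eq_of_simStar`). Since free objects are unique up to isomorphism, every free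
algebra and every free completely iterative algebra is such a quotient. Existence of a presentation
is the fact that a set is the filtered colimit of its finite subsets.

*Order.* What is used of the orders is only that they come from commuting idempotents `dₙ` with
`dₘ dₙ = d_{min m n}` that separate elements (`IsCutting`). The elements below `a` are then `a` itself
and the chain of the `dₙ a`, and `a` is the join of this chain (`IsCutting.isLUB_cut`). Hence a
map `f` is continuous iff each `f a` is the join of the `f (dₙ a)`
(`IsCutting.scottContinuous_iff`). Compatible sequences of cuttings form a poset of the same kind
that is a cpo (`IsCutting.isCpo`). All cuttings in it come from finite trees, so that a continuous
map on `Φ` or on `Ψ` extends uniquely by `c ↦ ⨆ n, f (dₙ c)`: this poset is the conservative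
completion of both (`IsCutting.isConservativeCompletion`). In the same way a continuous map on
`F Ψ + X` or `F Ψ` is determined by its values at cuttings, which lie in the image of `F Φ + X` or,
at positive heights, of `F Φ` (`IsCutting.isUniqueContinuousExtension`).
-/

namespace SetFunctor

/-! ### Posets ordered by cutting -/

/-- The partial order on `A` is the order by cutting for the family of maps `d n : A → A`
(cutting at height `n`): cutting twice is cutting once at the lower height, an element is
determined by its cuttings, and the elements strictly below `b` are cuttings of `b`. -/
structure IsCutting {A : Type*} [PartialOrder A] (d : ℕ → A → A) : Prop where
  cut_cut : ∀ m n a, d m (d n a) = d (min m n) a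
  separated : ∀ a b, (∀ n, d n a = d n b) → a = b
  le_iff : ∀ a b, a ≤ b ↔ a = b ∨ ∃ n, a = d n b

/-- The partial order given by a family of cuttings: `a ≤ b` iff `a = b` or `a` is a
cutting of `b`. -/
@[reducible]
def cuttingOrder {A : Type*} (d : ℕ → A → A) (hd : ∀ m n a, d m (d n a) = d (min m n) a) :
    PartialOrder A where
  le a b := a = b ∨ ∃ n, a = d n b
  le_refl a := Or.inl rfl
  le_trans := by
    rintro a b c (rfl | ⟨n, rfl⟩) (rfl | ⟨m, rfl⟩)
    · exact Or.inl rfl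
    · exact Or.inr ⟨m, rfl⟩
    · exact Or.inr ⟨n, rfl⟩
    · exact Or.inr ⟨min n m, hd n m c⟩
  le_antisymm := by
    rintro a b (h | ⟨n, h⟩) (h' | ⟨m, h'⟩)
    · exact h
    · exact h
    · exact h'.symm
    · rcases le_total n m with hnm | hnm
      · have h1 : a = d n a := by rw [h', hd, min_eq_left hnm] at h; exact h
        rw [h'] at h ⊢
        conv_rhs => rw [h1, hd, min_eq_right hnm]
        exact h1
      · have h1 : b = d m b := by rw [h, hd, min_eq_left hnm] at h'; exact h'
        rw [h]
        conv_lhs => rw [h1, hd, min_eq_right hnm]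
        exact h1.symm

/-- Every compatible sequence of cuttings is the sequence of cuttings of some element. -/
def IsCutComplete {A : Type*} (d : ℕ → A → A) : Prop :=
  ∀ c : ℕ → A, (∀ m n, d m (c n) = c (min m n)) → ∃ a, ∀ n, d n a = c n

namespace IsCutting

theorem cut_le {A : Type*} [PartialOrder A] {d : ℕ → A → A} (hd : IsCutting d) (n : ℕ) (a : A) :
    d n a ≤ a :=
  (hd.le_iff _ _).2 (Or.inr ⟨n, rfl⟩)

theorem cut_mono_height {A : Type*} [PartialOrder A] {d : ℕ → A → A} (hd : IsCutting d) {m n : ℕ}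
    (h : m ≤ n) (a : A) : d m a ≤ d n a := by
  have := hd.cut_le m (d n a)
  rwa [hd.cut_cut, min_eq_left h] at this

/-- Every element is the join of its cuttings at any unbounded set of heights. If `u` is an upper
bound and `a ≠ u`, the cuttings of `a` and `u` differ at some height `k`; from that height on, the
cuttings of `a`, which are cuttings of `u`, have to be cuttings at heights below `k`, so that `a`
itself equals one of them. -/
theorem isLUB_cut {A : Type*} [PartialOrder A] {d : ℕ → A → A} (hd : IsCutting d) (a : A)
    {N : Set ℕ} (hN : ∀ k, ∃ n ∈ N, k ≤ n) : IsLUB ((fun n => d n a) '' N) a := by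
  refine ⟨?_, fun u hu => ?_⟩
  · rintro _ ⟨n, -, rfl⟩
    exact hd.cut_le n a
  by_cases hau : ∀ k, d k a = d k u
  · exact (hd.separated _ _ hau).le
  push Not at hau
  obtain ⟨k, hk⟩ := hau
  have key : ∀ n ∈ N, k ≤ n → d n a = d k a := by
    intro n hn hkn
    rcases (hd.le_iff _ _).1 (hu ⟨n, hn, rfl⟩) with h | ⟨m, h⟩
    · exact absurd (by rw [← h, hd.cut_cut, min_eq_left hkn]) hk
    · rcases le_total k m with hkm | hmk
      · refine absurd ?_ hk
        have := congrArg (d k) h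
        rwa [hd.cut_cut, hd.cut_cut, min_eq_left hkn, min_eq_left hkm] at this
      · have := congrArg (d k) h
        rw [hd.cut_cut, hd.cut_cut, min_eq_left hkn, min_eq_right hmk] at this
        exact h.trans this.symm
  have ha : a = d k a := by
    refine hd.separated _ _ fun l => ?_
    obtain ⟨n, hn, hln⟩ := hN (max k l)
    rw [← key n hn (le_of_max_le_left hln), hd.cut_cut, min_eq_left (le_of_max_le_right hln)]
  obtain ⟨n, hn, hkn⟩ := hN k
  calc a = d k a := ha
    _ = d n a := (key n hn hkn).symm
    _ ≤ u := hu ⟨n, hn, rfl⟩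

theorem isLUB_range_cut {A : Type*} [PartialOrder A] {d : ℕ → A → A} (hd : IsCutting d) (a : A) :
    IsLUB (Set.range fun n => d n a) a := by
  rw [← Set.image_univ]
  exact hd.isLUB_cut a fun k => ⟨k, trivial, le_rfl⟩

/-- A nonempty set that does not contain its join `b` is cofinal in the chain of the cuttings
of `b`. -/
theorem exists_cut_le {A : Type*} [PartialOrder A] {d : ℕ → A → A} (hd : IsCutting d) {D : Set A}
    (hne : D.Nonempty) {b : A} (hb : IsLUB D b) (hbD : b ∉ D) (k : ℕ) : ∃ x ∈ D, d k b ≤ x := by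
  have hcut : ∀ x ∈ D, ∃ n, x = d n b := fun x hx =>
    ((hd.le_iff _ _).1 (hb.1 hx)).resolve_left fun h => hbD (h ▸ hx)
  induction k with
  | zero =>
    obtain ⟨x, hx⟩ := hne
    obtain ⟨n, rfl⟩ := hcut x hx
    exact ⟨_, hx, hd.cut_mono_height n.zero_le b⟩
  | succ l ih =>
    by_contra! hl
    -- then `d l b` is the greatest element of `D`, hence the join of `D`
    have hle : ∀ y ∈ D, y ≤ d l b := by
      intro y hy
      obtain ⟨n, rfl⟩ := hcut y hy
      refine hd.cut_mono_height (Nat.le_of_not_lt fun hn => hl _ hy ?_) b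
      exact hd.cut_mono_height hn b
    obtain ⟨x, hx, hlx⟩ := ih
    have hbx : b = x := le_antisymm ((hb.2 hle).trans hlx) (hb.1 hx)
    exact hbD (hbx ▸ hx)

theorem directedOn_range_cut {A : Type*} [PartialOrder A] {d : ℕ → A → A} (hd : IsCutting d)
    (a : A) : DirectedOn (· ≤ ·) (Set.range fun n => d n a) := by
  rintro _ ⟨m, rfl⟩ _ ⟨n, rfl⟩
  exact ⟨_, ⟨max m n, rfl⟩, hd.cut_mono_height (le_max_left m n) a,
    hd.cut_mono_height (le_max_right m n) a⟩

theorem scottContinuous_iff {A Q : Type*} [PartialOrder A] [PartialOrder Q] {d : ℕ → A → A}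
    (hd : IsCutting d) (f : A → Q) :
    ScottContinuous f ↔ ∀ a, IsLUB (Set.range fun n => f (d n a)) (f a) := by
  constructor
  · intro hf a
    have := hf (Set.range_nonempty _) (hd.directedOn_range_cut a) (hd.isLUB_range_cut a)
    rwa [← Set.range_comp] at this
  · intro hf D hne _ b hb
    have hmono : ∀ x y, x ≤ y → f x ≤ f y := by
      intro x y hxy
      rcases (hd.le_iff _ _).1 hxy with rfl | ⟨n, rfl⟩
      · exact le_rfl
      · exact (hf y).1 ⟨n, rfl⟩
    refine ⟨?_, fun u hu => ?_⟩
    · rintro _ ⟨x, hx, rfl⟩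
      exact hmono _ _ (hb.1 hx)
    · by_cases hbD : b ∈ D
      · exact hu ⟨b, hbD, rfl⟩
      refine (hf b).2 ?_
      rintro _ ⟨k, rfl⟩
      obtain ⟨x, hx, hkx⟩ := hd.exists_cut_le hne hb hbD k
      exact (hmono _ _ hkx).trans (hu ⟨x, hx, rfl⟩)

/-- In a directed set without a greatest element, the cuttings at each height are eventually
constant. -/
theorem exists_cut_eventually_eq {A : Type*} [PartialOrder A] {d : ℕ → A → A} (hd : IsCutting d)
    {D : Set A} (hne : D.Nonempty) (hD : DirectedOn (· ≤ ·) D) (hmax : ¬∃ a, IsGreatest D a)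
    (k : ℕ) : ∃ x ∈ D, ∀ y ∈ D, x ≤ y → d k y = d k x := by
  induction k with
  | zero =>
    obtain ⟨x, hx⟩ := hne
    refine ⟨x, hx, fun y _ hxy => ?_⟩
    rcases (hd.le_iff _ _).1 hxy with rfl | ⟨n, rfl⟩
    · rfl
    · rw [hd.cut_cut, Nat.zero_min]
  | succ k ih =>
    obtain ⟨x, hx, hxk⟩ := ih
    obtain ⟨w, hw, hwx⟩ : ∃ w ∈ D, ¬w ≤ x := by
      by_contra! h
      exact hmax ⟨x, hx, h⟩
    obtain ⟨z, hz, hxz, hwz⟩ := hD x hx w hw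
    refine ⟨z, hz, fun y hy hzy => ?_⟩
    rcases (hd.le_iff _ _).1 hzy with rfl | ⟨n, h⟩
    · rfl
    rcases Nat.lt_or_ge k n with hn | hn
    · rw [h, hd.cut_cut, min_eq_left (Nat.succ_le_of_lt hn)]
    · -- a cutting `z` of `y` at height at most `k` is one of `x` as well
      have hzx : z = d n x := by
        have := congrArg (d n) (hxk y hy (hxz.trans hzy))
        rwa [hd.cut_cut, hd.cut_cut, min_eq_left hn, ← h] at this
      exact absurd (hwz.trans (hzx ▸ hd.cut_le n x)) hwx

theorem isCpo {A : Type u} [PartialOrder A] {d : ℕ → A → A} (hd : IsCutting d)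
    (hc : IsCutComplete d) : IsCpo A := by
  intro D hne hD
  by_cases hmax : ∃ a, IsGreatest D a
  · obtain ⟨a, ha⟩ := hmax
    exact ⟨a, ha.isLUB⟩
  choose x hx hxe using hd.exists_cut_eventually_eq hne hD hmax
  obtain ⟨b, hb⟩ := hc (fun k => d k (x k)) <| by
    intro m n
    rcases le_total n m with h | h
    · simp only [hd.cut_cut, min_eq_right h]
    · obtain ⟨y, hy, hmy, hny⟩ := hD _ (hx m) _ (hx n)
      rw [← hxe n y hy hny, min_eq_left h, ← hxe m y hy hmy, hd.cut_cut, min_eq_left h]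
  refine ⟨b, fun a ha => ?_, fun u hu => (hd.isLUB_range_cut b).2 ?_⟩
  · obtain ⟨w, hw, hwa⟩ : ∃ w ∈ D, ¬w ≤ a := by
      by_contra! h
      exact hmax ⟨a, ha, h⟩
    obtain ⟨z, hz, haz, hwz⟩ := hD a ha w hw
    have hane : a ≠ z := fun h => hwa (h ▸ hwz)
    obtain ⟨n, hn⟩ := ((hd.le_iff _ _).1 haz).resolve_left hane
    obtain ⟨y, hy, hzy, hny⟩ := hD z hz _ (hx n)
    obtain ⟨l, hl, hly⟩ : ∃ l ≤ n, a = d l y := by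
      rcases (hd.le_iff _ _).1 hzy with rfl | ⟨l, h⟩
      · exact ⟨n, le_rfl, hn⟩
      · exact ⟨min n l, min_le_left _ _, by rw [hn, h, hd.cut_cut]⟩
    have : a = d l b := by
      have h := congrArg (d l) ((hxe n y hy hny).trans (hb n).symm)
      rwa [hd.cut_cut, hd.cut_cut, min_eq_left hl, ← hly] at h
    exact this ▸ hd.cut_le l b
  · rintro _ ⟨k, rfl⟩
    exact (hb k).le.trans ((hd.cut_le k (x k)).trans (hu (hx k)))

/-- A cut-complete poset is a conservative completion of every subposet that is closed under
cutting and contains all cuttings: a continuous map `f` on the subposet extends by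
`c ↦ ⨆ n, f (dₙ c)`. -/
theorem isConservativeCompletion {A C : Type u} [PartialOrder A] [PartialOrder C] {d : ℕ → A → A}
    {e : ℕ → C → C} (hd : IsCutting d) (he : IsCutting e) (hc : IsCutComplete e) {j : A → C}
    (hj : Function.Injective j) (hjd : ∀ n a, j (d n a) = e n (j a))
    (hr : ∀ n c, ∃ a, j a = e n c) : IsConservativeCompletion j where
  isCpo := he.isCpo hc
  le_iff_le x y := by
    simp only [hd.le_iff, he.le_iff, ← hjd, hj.eq_iff]
  continuous := by
    rw [hd.scottContinuous_iff]
    intro a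
    simpa only [hjd] using he.isLUB_range_cut (j a)
  universal Q _ hQ f hf := by
    choose r hr using hr
    have hrj : ∀ n a, r n (j a) = d n a := fun n a => hj (by rw [hr, hjd])
    have hre : ∀ m n c, r m (e n c) = r (min m n) c := fun m n c => hj (by
      rw [hr, hr, he.cut_cut])
    have hrd : ∀ m n c, d m (r n c) = r (min m n) c := fun m n c => by
      rw [← hrj, hr, hre]
    have hmono : ∀ c, Monotone fun n => f (r n c) := by
      intro c m n hmn
      refine hf.monotone ?_
      rw [← min_eq_left hmn, ← hrd]
      exact hd.cut_le _ _
    have hsup : ∀ c, ∃ b, IsLUB (Set.range fun n => f (r n c)) b := fun c =>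
      hQ _ (Set.range_nonempty _) (directedOn_range.2 (hmono c).directed_le)
    choose g hg using hsup
    have hgj : ∀ a, g (j a) = f a := by
      intro a
      refine (hg (j a)).unique ?_
      simpa only [hrj] using (hd.scottContinuous_iff f).1 hf a
    refine ⟨g, ⟨(he.scottContinuous_iff g).2 fun c => ?_, hgj⟩, fun g' ⟨hg', hgj'⟩ => ?_⟩
    · simpa only [← hr, hgj] using hg c
    · funext c
      refine IsLUB.unique ((he.scottContinuous_iff g').1 hg' c) ?_
      simpa only [← hr, hgj'] using hg c

/-- The cut-complete poset of all compatible sequences of cuttings receives `A` by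
`a ↦ (dₙ a)ₙ`, and every cutting of a compatible sequence comes from `A`. -/
theorem exists_cutComplete {A : Type u} [PartialOrder A] {d : ℕ → A → A} (hd : IsCutting d) :
    ∃ (C : Type u) (_ : PartialOrder C) (e : ℕ → C → C) (j : A → C), IsCutting e ∧
      IsCutComplete e ∧ Function.Injective j ∧ (∀ n a, j (d n a) = e n (j a)) ∧
      ∀ n c, ∃ a, j (d n a) = e n c := by
  let C := {c : ℕ → A // ∀ m n, d m (c n) = c (min m n)}
  let e : ℕ → C → C := fun n c => ⟨fun k => c.1 (min k n), fun k l => by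
    simp only [c.2, min_assoc]⟩
  have hee : ∀ m n c, e m (e n c) = e (min m n) c := fun m n c => Subtype.ext <| by
    funext k
    simp only [e, min_assoc]
  let _ : PartialOrder C := cuttingOrder e hee
  refine ⟨C, inferInstance, e, fun a => ⟨fun n => d n a, fun m n => hd.cut_cut m n a⟩,
    ⟨hee, fun a b h => Subtype.ext ?_, fun a b => Iff.rfl⟩, ?_, ?_, ?_, ?_⟩
  · funext k
    have := congrFun (congrArg Subtype.val (h k)) k
    simpa only [e, min_self] using this
  · intro c hc
    have hc' : ∀ m n k, (c n).1 (min k m) = (c (min m n)).1 k := fun m n k =>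
      congrFun (congrArg Subtype.val (hc m n)) k
    -- the diagonal of a compatible sequence of sequences
    refine ⟨⟨fun n => (c n).1 n, fun m n => ?_⟩, fun n => Subtype.ext ?_⟩
    · have h := hc' m n (min m n)
      rw [min_eq_left (min_le_left m n)] at h
      exact ((c n).2 m n).trans h
    · funext k
      change (c (min k n)).1 (min k n) = (c n).1 k
      have h1 := hc' k n (min k n)
      have h2 := hc' n n k
      rw [min_eq_left (min_le_left k n)] at h1
      rw [min_self] at h2
      rw [← h1, h2]
  · intro a b h
    exact hd.separated _ _ fun n => congrFun (congrArg Subtype.val h) n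
  · intro n a
    refine Subtype.ext (funext fun k => ?_)
    exact hd.cut_cut k n a
  · intro n c
    refine ⟨c.1 n, Subtype.ext (funext fun k => ?_)⟩
    change d k (d n (c.1 n)) = c.1 (min k n)
    rw [c.2 n n, min_self, c.2]

/-- A structure map `b : T → B` is continuous and is determined by its values on `i : S → T`,
provided that the cuttings at positive heights of elements in its range come from `S`, and that at
most one cutting of an element outside its range lies in its range. -/
theorem isUniqueContinuousExtension {S T A B : Type u} [PartialOrder B] {d : ℕ → B → B}
    (hd : IsCutting d) {a : S → A} {b : T → B} {i : S → T} {m : A → B}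
    (hext : ∀ x, b (i x) = m (a x)) (hrange : ∀ t n, ∃ x, b (i x) = d (n + 1) (b t))
    (hout : ∀ u ∉ Set.range b, ∀ n, d n u ∈ Set.range b → d n u = d 0 u) :
    IsUniqueContinuousExtension a b i m where
  continuous := by
    let _ : Preorder T := Preorder.lift b
    intro D hne _ c hc
    refine ⟨?_, fun u hu => ?_⟩
    · rintro _ ⟨x, hx, rfl⟩
      exact hc.1 hx
    by_cases hub : u ∈ Set.range b
    · obtain ⟨v, rfl⟩ := hub
      exact hc.2 fun x hx => hu ⟨x, hx, rfl⟩
    · -- all elements of `D` have the same image, so the join is attained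
      have key : ∀ x ∈ D, b x = d 0 u := by
        intro x hx
        obtain ⟨n, hn⟩ := ((hd.le_iff _ _).1 (hu ⟨x, hx, rfl⟩)).resolve_left
          fun h => hub ⟨x, h⟩
        rw [hn]
        exact hout u hub n ⟨x, hn⟩
      obtain ⟨x, hx⟩ := hne
      have hcx : c ≤ x := hc.2 fun y hy => by
        change b y ≤ b x
        rw [key y hy, key x hx]
      exact le_trans (show b c ≤ b x from hcx) (hu ⟨x, hx, rfl⟩)
  extends_base := hext
  unique h hh hi := by
    let _ : Preorder T := Preorder.lift b
    funext t
    choose z hz using hrange t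
    have hlub : IsLUB (Set.range fun n => d (n + 1) (b t)) (b t) := by
      have := hd.isLUB_cut (b t) (N := Set.range (· + 1)) fun k => ⟨k + 1, ⟨k, rfl⟩, k.le_succ⟩
      rwa [← Set.range_comp] at this
    have hlubT : IsLUB (Set.range fun n => i (z n)) t := by
      refine ⟨?_, fun u hu => ?_⟩
      · rintro _ ⟨n, rfl⟩
        change b (i (z n)) ≤ b t
        exact (hz n).le.trans (hd.cut_le _ _)
      · change b t ≤ b u
        refine hlub.2 ?_
        rintro _ ⟨n, rfl⟩
        exact (hz n).ge.trans (hu ⟨n, rfl⟩)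
    have hdir : DirectedOn (· ≤ ·) (Set.range fun n => i (z n)) := by
      refine directedOn_range.2 (Monotone.directed_le fun m n hmn => ?_)
      change b (i (z m)) ≤ b (i (z n))
      rw [hz, hz]
      exact hd.cut_mono_height (Nat.succ_le_succ hmn) _
    have := hh (Set.range_nonempty _) hdir hlubT
    rw [← Set.range_comp] at this
    refine this.unique ?_
    simpa only [Function.comp_def, hi, ← hext, hz] using hlub

end IsCutting
/-! ### Every finitary set functor has a presentation -/

/-- Evaluation of generic elements: the signature consists of all elements of `F n`, and the flat
term `σ(x₁, …, xₙ)` is sent to the value of `F x : F n → F X` at `σ`. -/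
def canonicalTransformation (F : Type u ⥤ Type u) :
    polynomialFunctor ⟨fun n => F.obj (ULift.{u} (Fin n))⟩ ⟶ F where
  app X := TypeCat.ofHom fun t => F.map (TypeCat.ofHom fun i => t.2.2 i.down) t.2.1
  naturality X Y f := by
    ext t
    exact (Functor.map_comp_apply F (TypeCat.ofHom fun i => t.2.2 (ULift.down i)) f t.2.1)

/-- A set is the filtered colimit of its finite subsets. As `F` preserves it, each element of
`F X` comes from a finite subset of `X`. -/
theorem exists_finset_map_eq (F : Type u ⥤ Type u) [Limits.PreservesFilteredColimits F]
    (X : Type u) (z : F.obj X) :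
    ∃ (s : Finset X) (w : F.obj s), F.map (TypeCat.ofHom Subtype.val) w = z := by
  classical
  let D : Finset X ⥤ Type u :=
    { obj := fun s => s
      map := fun {s t} f => TypeCat.ofHom fun x => ⟨x.1, leOfHom f x.2⟩ }
  let c : Limits.Cocone D :=
    { pt := X
      ι := { app := fun s => TypeCat.ofHom Subtype.val } }
  have hc : Limits.IsColimit c := by
    refine Limits.Types.FilteredColimit.isColimitOf' D c (fun x => ?_) fun s x y h => ?_
    · exact ⟨{x}, ⟨x, Finset.mem_singleton_self x⟩, rfl⟩
    · exact ⟨s, 𝟙 s, congrArg _ (Subtype.ext h)⟩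
  exact Limits.Types.jointly_surjective_of_isColimit (Limits.isColimitOfPreserves F hc) z

theorem nonempty_presentation (F : Type u ⥤ Type u) [Limits.PreservesFilteredColimits F] :
    Nonempty (Presentation F) := by
  refine ⟨⟨_, canonicalTransformation F, fun X z => ?_⟩⟩
  obtain ⟨s, w, rfl⟩ := exists_finset_map_eq F X z
  let e := s.equivFin
  refine ⟨⟨s.card, F.map (TypeCat.ofHom fun x => ULift.up (e x)) w, fun i => (e.symm i).1⟩, ?_⟩
  change F.map _ (F.map _ w) = _
  rw [← Functor.map_comp_apply]
  refine ConcreteCategory.congr_hom (congrArg F.map ?_) w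
  ext x
  exact congrArg Subtype.val (e.symm_apply_apply x)

/-! ### Algebras of a presented functor -/

variable {F : Type u ⥤ Type u}

theorem map_flat (P : Presentation F) {X Y : Type u} (f : X → Y) {n : ℕ} (σ : P.sig.Op n)
    (x : Fin n → X) :
    F.map (TypeCat.ofHom f) (P.ε.app X (flat σ x)) = P.ε.app Y (flat σ fun i => f (x i)) :=
  (ConcreteCategory.congr_hom (P.ε.naturality (TypeCat.ofHom f)) (flat (X := X) σ x)).symm

theorem exists_flat (P : Presentation F) {X : Type u} (z : F.obj X) :
    ∃ (n : ℕ) (σ : P.sig.Op n) (x : Fin n → X), P.ε.app X (flat σ x) = z := by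
  obtain ⟨⟨n, σ, x⟩, h⟩ := P.surjective X z
  exact ⟨n, σ, x, h⟩

theorem hom_str_apply {A B : Endofunctor.Algebra F} (h : A ⟶ B) (z : F.obj A.a) :
    h.f (A.str z) = B.str (F.map h.f z) :=
  (ConcreteCategory.congr_hom h.h z).symm

theorem hom_op (P : Presentation F) {A B : Endofunctor.Algebra F} (h : A ⟶ B) {n : ℕ}
    (σ : P.sig.Op n) (x : Fin n → A.a) :
    h.f (A.str (P.ε.app A.a (flat σ x))) = B.str (P.ε.app B.a (flat σ fun i => h.f (x i))) := by
  rw [hom_str_apply]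
  exact congrArg _ (map_flat P h.f σ x)

/-- A map that preserves the operations is a homomorphism. -/
def homOfOp (P : Presentation F) {A B : Endofunctor.Algebra F} (h : A.a → B.a)
    (hh : ∀ {n : ℕ} (σ : P.sig.Op n) (x : Fin n → A.a),
      h (A.str (P.ε.app A.a (flat σ x))) = B.str (P.ε.app B.a (flat σ fun i => h (x i)))) :
    A ⟶ B where
  f := TypeCat.ofHom h
  h := by
    ext z
    obtain ⟨n, σ, x, rfl⟩ := exists_flat P z
    exact (congrArg _ (map_flat P h σ x)).trans (hh σ x).symm

theorem hom_ext {A B : Endofunctor.Algebra F} {g h : A ⟶ B} (hgh : ∀ x, g.f x = h.f x) : g = h :=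
  Endofunctor.Algebra.ext (by ext x; exact hgh x)

/-- The algebra on the quotient of a `Σ`-algebra `T` by an equivalence relation; the value of the
structure map at an element of `F (T / ∼)` is computed with the chosen flat term that presents it
and the chosen representatives of its variables. -/
noncomputable def quotientAlgebra (P : Presentation F) {T : Type u} (r : Setoid T)
    (op : ∀ {n : ℕ}, P.sig.Op n → (Fin n → T) → T) : Endofunctor.Algebra F where
  a := Quotient r
  str := TypeCat.ofHom fun z =>
    let w := Function.surjInv (P.surjective (Quotient r)) z
    Quotient.mk r (op w.2.1 fun i => (w.2.2 i).out)

/-- If the relation is a congruence and identifies the two sides of every `ε`-equation between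
the chosen representatives, the quotient map preserves the operations. -/
theorem quotientAlgebra_str (P : Presentation F) {T : Type u} (r : Setoid T)
    (op : ∀ {n : ℕ}, P.sig.Op n → (Fin n → T) → T)
    (congr : ∀ {n : ℕ} (σ : P.sig.Op n) (s t : Fin n → T), (∀ i, r (s i) (t i)) →
      r (op σ s) (op σ t))
    (equation : ∀ {n m : ℕ} (σ : P.sig.Op n) (τ : P.sig.Op m) (x : Fin n → Quotient r)
      (y : Fin m → Quotient r), P.ε.app _ (flat σ x) = P.ε.app _ (flat τ y) →
      r (op σ fun i => (x i).out) (op τ fun j => (y j).out))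
    {n : ℕ} (σ : P.sig.Op n) (t : Fin n → T) :
    (quotientAlgebra P r op).str (P.ε.app _ (flat σ fun i => Quotient.mk r (t i))) =
      Quotient.mk r (op σ t) := by
  refine Quotient.sound (r.trans (equation _ σ _ (fun i => Quotient.mk r (t i)) ?_)
    (congr σ _ t fun i => ?_))
  · exact Function.surjInv_eq (P.surjective (Quotient r)) _
  · exact Quotient.mk_out (t i)

/-! ### Finite trees -/

variable {X : Type u}

namespace IsFinTreeQuotient

variable {P : Presentation F} {A : Endofunctor.Algebra F} {η : X → A.a} {q : FinTree P.sig X → A.a}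

/-- The top part of a finite tree modulo `∼`: the flat term formed by its root and the classes of
its maximal proper subtrees, or its variable. -/
def root (_ : IsFinTreeQuotient P A η q) : FinTree P.sig X → F.obj A.a ⊕ X
  | .var x => Sum.inr x
  | .app σ t => Sum.inl (P.ε.app A.a (flat σ fun i => q (t i)))

theorem elim_root (hq : IsFinTreeQuotient P A η q) (s : FinTree P.sig X) :
    Sum.elim (fun t => A.str t) η (hq.root s) = q s := by
  cases s with
  | var x => exact (hq.map_var x).symm
  | app σ t => exact (hq.map_app σ t).symm

theorem root_eq_of_sim (hq : IsFinTreeQuotient P A η q) {s t : FinTree P.sig X} (h : Sim P s t) :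
    hq.root s = hq.root t := by
  induction h with
  | equation σ τ x y h f =>
    have := congrArg (F.map (TypeCat.ofHom fun z => q (f z))) h
    rw [map_flat, map_flat] at this
    exact congrArg Sum.inl this
  | congr σ s t h _ =>
    have : (fun i => q (s i)) = fun i => q (t i) := funext fun i => (hq.eq_iff _ _).2 (h i)
    simp only [root, this]
  | refl s => rfl
  | symm _ ih => exact ih.symm
  | trans _ _ ih ih' => exact ih.trans ih'

/-- Lambek's lemma for the algebra of finite trees modulo `∼`: it is the coproduct of its
operations and its variables. -/
theorem bijective (hq : IsFinTreeQuotient P A η q) :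
    Function.Bijective (Sum.elim (fun t => A.str t) η) := by
  have hroot : ∀ z, ∃ s, hq.root s = z := by
    rintro (z | x)
    · obtain ⟨n, σ, x, rfl⟩ := exists_flat P z
      choose t ht using fun i => hq.surjective (x i)
      exact ⟨.app σ t, by simp only [root, ht]⟩
    · exact ⟨.var x, rfl⟩
  refine ⟨fun z w h => ?_, fun y => ?_⟩
  · obtain ⟨s, rfl⟩ := hroot z
    obtain ⟨t, rfl⟩ := hroot w
    rw [elim_root, elim_root] at h
    exact hq.root_eq_of_sim ((hq.eq_iff s t).1 h)
  · obtain ⟨s, rfl⟩ := hq.surjective y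
    exact ⟨_, hq.elim_root s⟩

end IsFinTreeQuotient

/-- Evaluation of finite trees in an algebra. -/
def FinTree.eval (P : Presentation F) (B : Endofunctor.Algebra F) (f : X → B.a) :
    FinTree P.sig X → B.a
  | .var x => f x
  | .app σ t => B.str (P.ε.app B.a (flat σ fun i => (t i).eval P B f))

theorem Sim.eval_eq {P : Presentation F} (B : Endofunctor.Algebra F) (f : X → B.a)
    {s t : FinTree P.sig X} (h : Sim P s t) : s.eval P B f = t.eval P B f := by
  induction h with
  | equation σ τ x y h g =>
    have := congrArg (F.map (TypeCat.ofHom fun z => (g z).eval P B f)) h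
    rw [map_flat, map_flat] at this
    exact congrArg (fun z => B.str z) this
  | congr σ s t _ ih => simp only [FinTree.eval, ih]
  | refl s => rfl
  | symm _ ih => exact ih.symm
  | trans _ _ ih ih' => exact ih.trans ih'

theorem IsFinTreeQuotient.hom_apply {P : Presentation F} {A : Endofunctor.Algebra F} {η : X → A.a}
    {q : FinTree P.sig X → A.a} (hq : IsFinTreeQuotient P A η q) {B : Endofunctor.Algebra F}
    {f : X → B.a} (h : A ⟶ B) (hh : ∀ x, h.f (η x) = f x) (s : FinTree P.sig X) :
    h.f (q s) = s.eval P B f := by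
  induction s with
  | var x => rw [hq.map_var, hh, FinTree.eval]
  | app σ t ih => simp only [hq.map_app, hom_op, ih, FinTree.eval]

theorem IsFinTreeQuotient.isFreeAlgebra {P : Presentation F} {A : Endofunctor.Algebra F}
    {η : X → A.a} {q : FinTree P.sig X → A.a} (hq : IsFinTreeQuotient P A η q) :
    IsFreeAlgebra A η := by
  intro B f
  let g : A.a → B.a := fun y => (Function.surjInv hq.surjective y).eval P B f
  have hg : ∀ s, g (q s) = s.eval P B f := fun s =>
    ((hq.eq_iff _ _).1 (Function.surjInv_eq hq.surjective (q s))).eval_eq B f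
  refine ⟨homOfOp P g fun σ x => ?_, fun x => ?_, fun h hh => hom_ext fun y => ?_⟩
  · choose t ht using fun i => hq.surjective (x i)
    obtain rfl : (fun i => q (t i)) = x := funext ht
    rw [← hq.map_app, hg]
    simp only [hg, FinTree.eval]
  · change g (η x) = f x
    rw [← hq.map_var, hg, FinTree.eval]
  · obtain ⟨s, rfl⟩ := hq.surjective y
    exact (hq.hom_apply h hh s).trans (hg s).symm

theorem exists_isFinTreeQuotient (P : Presentation F) (X : Type u) :
    ∃ (A : Endofunctor.Algebra F) (η : X → A.a) (q : FinTree P.sig X → A.a),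
      IsFinTreeQuotient P A η q := by
  let r : Setoid (FinTree P.sig X) := ⟨Sim P, Sim.refl, Sim.symm, Sim.trans⟩
  refine ⟨quotientAlgebra P r FinTree.app, fun x => Quotient.mk r (.var x), Quotient.mk r,
    fun _ => rfl, fun σ t => (quotientAlgebra_str P r FinTree.app Sim.congr ?_ σ t).symm,
    Quotient.mk_surjective, fun s t => Quotient.eq⟩
  exact fun σ τ x y h => Sim.equation σ τ x y h Quotient.out

/-- Free algebras with respect to a class `𝒞` of algebras are unique up to isomorphism. -/
theorem exists_bijective_hom (𝒞 : Endofunctor.Algebra F → Prop) {A B : Endofunctor.Algebra F}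
    {η : X → A.a} {θ : X → B.a} (hA : 𝒞 A) (hB : 𝒞 B)
    (uA : ∀ D, 𝒞 D → ∀ f : X → D.a, ∃! h : A ⟶ D, ∀ x, h.f (η x) = f x)
    (uB : ∀ D, 𝒞 D → ∀ f : X → D.a, ∃! h : B ⟶ D, ∀ x, h.f (θ x) = f x) :
    ∃ h : A ⟶ B, (∀ x, h.f (η x) = θ x) ∧ Function.Bijective h.f := by
  obtain ⟨h, hh, -⟩ := uA B hB θ
  obtain ⟨g, hg, -⟩ := uB A hA η
  have h1 : h ≫ g = 𝟙 A := (uA A hA η).unique (fun x => (congrArg g.f (hh x)).trans (hg x))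
    fun _ => rfl
  have h2 : g ≫ h = 𝟙 B := (uB B hB θ).unique (fun x => (congrArg h.f (hg x)).trans (hh x))
    fun _ => rfl
  refine ⟨h, hh, Function.bijective_iff_has_inverse.2 ⟨g.f, fun x => ?_, fun y => ?_⟩⟩
  · exact ConcreteCategory.congr_hom (congrArg Endofunctor.Algebra.Hom.f h1) x
  · exact ConcreteCategory.congr_hom (congrArg Endofunctor.Algebra.Hom.f h2) y

theorem IsFreeAlgebra.exists_isFinTreeQuotient (P : Presentation F) {A : Endofunctor.Algebra F}
    {η : X → A.a} (hA : IsFreeAlgebra A η) :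
    ∃ q : FinTree P.sig X → A.a, IsFinTreeQuotient P A η q := by
  obtain ⟨B, θ, q, hq⟩ := SetFunctor.exists_isFinTreeQuotient P X
  obtain ⟨h, hh, hbij⟩ := exists_bijective_hom (fun _ => True) trivial trivial
    (fun D _ => hq.isFreeAlgebra D) fun D _ => hA D
  refine ⟨fun s => h.f (q s), fun x => ?_, fun σ t => ?_, hbij.2.comp hq.surjective, fun s t => ?_⟩
  · rw [hq.map_var, hh]
  · rw [hq.map_app, hom_op]
  · rw [hbij.1.eq_iff, hq.eq_iff]

/-! ### Cutting of trees -/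

section Cutting

variable {S : Signature.{u}}

theorem Tree.exists_eq (t : Tree S X) :
    (∃ x, t = Tree.var x) ∨ ∃ (n : ℕ) (σ : S.Op n) (s : Fin n → Tree S X), t = Tree.app σ s := by
  rw [← PFunctor.M.mk_dest (F := nodeShape S X) t]
  rcases PFunctor.M.dest (F := nodeShape S X) t with ⟨⟨n, σ⟩ | x, f⟩
  · exact Or.inr ⟨n, σ, f, rfl⟩
  · refine Or.inl ⟨x, ?_⟩
    have : f = fun i : Empty => i.elim := funext fun i : Empty => i.elim
    rw [this]
    rfl

variable (p : S.Op 0 ⊕ X)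

theorem cut_zero (t : Tree S X) : cut p 0 t = pointTree p := rfl

theorem cut_succ_var (n : ℕ) (x : X) : cut p (n + 1) (Tree.var x : Tree S X) = .var x := rfl

theorem cut_succ_app (n : ℕ) {k : ℕ} (σ : S.Op k) (t : Fin k → Tree S X) :
    cut p (n + 1) (Tree.app σ t) = .app σ fun i => cut p n (t i) := rfl

theorem cut_pointTree (n : ℕ) : cut p n (pointTree p).toTree = pointTree p := by
  cases n with
  | zero => rfl
  | succ n =>
    rcases p with c | x
    · simp only [pointTree, FinTree.toTree, cut_succ_app]
      congr 1
      exact funext fun i => i.elim0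
    · rfl

theorem cut_cut (m n : ℕ) (t : Tree S X) : cut p m (cut p n t).toTree = cut p (min m n) t := by
  induction m generalizing n t with
  | zero => rw [Nat.zero_min, cut_zero, cut_zero]
  | succ m ih =>
    cases n with
    | zero => exact cut_pointTree p (m + 1)
    | succ n =>
      rw [Nat.succ_min_succ]
      obtain ⟨x, rfl⟩ | ⟨k, σ, s, rfl⟩ := t.exists_eq
      · rfl
      · simp only [cut_succ_app, FinTree.toTree, ih]

theorem exists_cut_toTree_eq (s : FinTree S X) : ∃ N, ∀ n, N ≤ n → cut p n s.toTree = s := by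
  induction s with
  | var x =>
    refine ⟨1, fun n hn => ?_⟩
    obtain ⟨n, rfl⟩ := Nat.exists_eq_add_of_le' hn
    rfl
  | app σ t ih =>
    choose N hN using ih
    refine ⟨Finset.univ.sup N + 1, fun n hn => ?_⟩
    obtain ⟨n, rfl⟩ := Nat.exists_eq_add_of_le' (Nat.le_of_add_left_le hn)
    rw [FinTree.toTree, cut_succ_app]
    congr 1
    exact funext fun i => hN i n ((Finset.le_sup (Finset.mem_univ i)).trans (by omega))

end Cutting

section

variable {P : Presentation F} (p : P.sig.Op 0 ⊕ X)

/-- Both generating rules of `∼` only involve the root and whole subtrees, so that `∼` is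
compatible with cutting. -/
theorem Sim.cut {s t : FinTree P.sig X} (h : Sim P s t) (n : ℕ) :
    Sim P (cut p n s.toTree) (cut p n t.toTree) := by
  induction h generalizing n with
  | equation σ τ x y h f =>
    cases n with
    | zero => exact Sim.refl _
    | succ n => exact Sim.equation σ τ x y h fun z => SetFunctor.cut p n (f z).toTree
  | congr σ s t _ ih =>
    cases n with
    | zero => exact Sim.refl _
    | succ n => exact Sim.congr σ _ _ fun i => ih i n
  | refl s => exact Sim.refl _
  | symm _ ih => exact (ih n).symm
  | trans _ _ ih ih' => exact (ih n).trans (ih' n)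

theorem simStar_toTree_iff (s t : FinTree P.sig X) :
    SimStar P p s.toTree t.toTree ↔ Sim P s t := by
  refine ⟨fun h => ?_, fun h n => h.cut p n⟩
  obtain ⟨N, hN⟩ := exists_cut_toTree_eq p s
  obtain ⟨M, hM⟩ := exists_cut_toTree_eq p t
  have := h (max N M)
  rwa [hN _ (le_max_left N M), hM _ (le_max_right N M)] at this

theorem Sim.cut_of_le {s t : Tree P.sig X} {m n : ℕ} (hmn : m ≤ n)
    (h : Sim P (SetFunctor.cut p n s) (SetFunctor.cut p n t)) :
    Sim P (SetFunctor.cut p m s) (SetFunctor.cut p m t) := by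
  have := h.cut p m
  rwa [cut_cut, cut_cut, min_eq_left hmn] at this

end

/-! ### Arbitrary trees modulo `∼*` -/

namespace IsTreeQuotient

variable {P : Presentation F} {p : P.sig.Op 0 ⊕ X} {A B : Endofunctor.Algebra F} {η : X → A.a}
  {θ : X → B.a} {q : FinTree P.sig X → A.a} {k : Tree P.sig X → B.a}

/-- Cutting at height `n`, as a map from classes of trees to classes of finite trees. -/
noncomputable def trunc (hk : IsTreeQuotient P p B θ k) (q : FinTree P.sig X → A.a) (n : ℕ)
    (y : B.a) : A.a :=
  q (cut p n (Function.surjInv hk.surjective y))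

theorem trunc_apply (hk : IsTreeQuotient P p B θ k) (hq : IsFinTreeQuotient P A η q) (n : ℕ)
    (t : Tree P.sig X) : hk.trunc q n (k t) = q (cut p n t) :=
  (hq.eq_iff _ _).2 ((hk.eq_iff _ _).1 (Function.surjInv_eq hk.surjective (k t)) n)

theorem eq_of_trunc_eq (hk : IsTreeQuotient P p B θ k) (hq : IsFinTreeQuotient P A η q) {y z : B.a}
    (h : ∀ n, hk.trunc q n y = hk.trunc q n z) : y = z := by
  obtain ⟨s, rfl⟩ := hk.surjective y
  obtain ⟨t, rfl⟩ := hk.surjective z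
  simp only [hk.trunc_apply hq] at h
  exact (hk.eq_iff s t).2 fun n => (hq.eq_iff _ _).1 (h n)

theorem trunc_succ_str (hk : IsTreeQuotient P p B θ k) (hq : IsFinTreeQuotient P A η q) (n : ℕ)
    (z : F.obj B.a) :
    hk.trunc q (n + 1) (B.str z) = A.str (F.map (TypeCat.ofHom (hk.trunc q n)) z) := by
  obtain ⟨m, σ, x, rfl⟩ := exists_flat P z
  choose t ht using fun i => hk.surjective (x i)
  obtain rfl : (fun i => k (t i)) = x := funext ht
  rw [← hk.map_app, hk.trunc_apply hq, cut_succ_app, hq.map_app, map_flat]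
  simp only [hk.trunc_apply hq]

/-- Finitely many trees are distinguished modulo `∼*` by their cuttings at a single height. -/
theorem exists_height (hk : IsTreeQuotient P p B θ k) (hq : IsFinTreeQuotient P A η q) {I : Type}
    [Finite I] (t : I → Tree P.sig X) :
    ∃ n, ∀ i j, q (cut p n (t i)) = q (cut p n (t j)) → k (t i) = k (t j) := by
  have : ∀ᶠ n in Filter.atTop, ∀ i j, q (cut p n (t i)) = q (cut p n (t j)) →
      k (t i) = k (t j) := by
    refine Filter.eventually_all.2 fun i => Filter.eventually_all.2 fun j => ?_
    by_cases hij : k (t i) = k (t j)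
    · exact Filter.Eventually.of_forall fun _ _ => hij
    · obtain ⟨m, hm⟩ := not_forall.1 (mt (hk.eq_iff _ _).2 hij)
      filter_upwards [Filter.eventually_ge_atTop m] with n hmn h
      exact absurd (Sim.cut_of_le p hmn ((hq.eq_iff _ _).1 h)) hm
  exact this.exists

/-- If `σ(s₁, …) ∼* τ(t₁, …)`, then the flat terms `σ([s₁], …)` and `τ([t₁], …)` are merged
by `ε`. They are merged after cutting the subtrees at any height, and at a height that
distinguishes all the classes involved the cutting can be undone by a map on classes. -/
theorem ε_eq_of_simStar (hk : IsTreeQuotient P p B θ k) {n m : ℕ} {σ : P.sig.Op n}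
    {τ : P.sig.Op m} {s : Fin n → Tree P.sig X} {t : Fin m → Tree P.sig X}
    (h : SimStar P p (Tree.app σ s) (Tree.app τ t)) :
    P.ε.app B.a (flat σ fun i => k (s i)) = P.ε.app B.a (flat τ fun i => k (t i)) := by
  obtain ⟨A, η, q, hq⟩ := exists_isFinTreeQuotient P X
  obtain ⟨l, hl⟩ := hk.exists_height hq (Sum.elim s t)
  have hroot : P.ε.app A.a (flat σ fun i => q (cut p l (s i))) =
      P.ε.app A.a (flat τ fun i => q (cut p l (t i))) :=
    Sum.inl.inj (hq.root_eq_of_sim (h (l + 1)))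
  let g : A.a → B.a := Function.extend (fun i => q (cut p l (Sum.elim s t i)))
    (fun i => k (Sum.elim s t i)) fun _ => k (pointTree p).toTree
  have hg : ∀ i, g (q (cut p l (Sum.elim s t i))) = k (Sum.elim s t i) := fun i =>
    Function.FactorsThrough.extend_apply (fun i j hij => hl i j hij) _ i
  have := congrArg (F.map (TypeCat.ofHom g)) hroot
  rw [map_flat, map_flat] at this
  have hs : (fun i => g (q (cut p l (s i)))) = fun i => k (s i) := funext fun i => hg (Sum.inl i)
  have ht : (fun i => g (q (cut p l (t i)))) = fun i => k (t i) := funext fun i => hg (Sum.inr i)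
  rwa [hs, ht] at this

/-- Lambek's lemma for the algebra of all trees modulo `∼*`. -/
theorem bijective (hk : IsTreeQuotient P p B θ k) :
    Function.Bijective (Sum.elim (fun t => B.str t) θ) := by
  obtain ⟨A, η, q, hq⟩ := exists_isFinTreeQuotient P X
  have hex : ∀ z : F.obj B.a, ∃ (n : ℕ) (σ : P.sig.Op n) (t : Fin n → Tree P.sig X),
      P.ε.app B.a (flat σ fun i => k (t i)) = z := by
    intro z
    obtain ⟨n, σ, x, rfl⟩ := exists_flat P z
    choose t ht using fun i => hk.surjective (x i)
    exact ⟨n, σ, t, by simp only [ht]⟩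
  have hne : ∀ z x, B.str z ≠ θ x := by
    intro z x h
    obtain ⟨n, σ, t, rfl⟩ := hex z
    rw [← hk.map_app, ← hk.map_var, hk.eq_iff] at h
    exact Sum.inl_ne_inr (hq.root_eq_of_sim (h 1))
  refine ⟨?_, fun y => ?_⟩
  · rintro (z | x) (w | y) h
    · obtain ⟨n, σ, s, rfl⟩ := hex z
      obtain ⟨m, τ, t, rfl⟩ := hex w
      simp only [Sum.elim_inl, ← hk.map_app, hk.eq_iff] at h
      rw [hk.ε_eq_of_simStar h]
    · exact absurd h (hne z y)
    · exact absurd h.symm (hne w x)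
    · simp only [Sum.elim_inr, ← hk.map_var, hk.eq_iff] at h
      exact congrArg Sum.inr (Sum.inr.inj (hq.root_eq_of_sim (h 1)))
  · obtain ⟨t, rfl⟩ := hk.surjective y
    obtain ⟨x, rfl⟩ | ⟨n, σ, s, rfl⟩ := t.exists_eq
    · exact ⟨Sum.inr x, (hk.map_var x).symm⟩
    · exact ⟨Sum.inl _, (hk.map_app σ s).symm⟩

/-- The one-step unfolding of a recursive equation `e : Y → F Y + B`: an unknown `y` with `e y` in
`F Y` is unfolded along a flat term that presents `e y`, one with `e y` in `B` along a tree
that represents `e y`. -/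
noncomputable def unfold (hk : IsTreeQuotient P p B θ k) {Y : Type u} (e : Y → F.obj Y ⊕ B.a) :
    Y ⊕ Tree P.sig X → nodeShape P.sig X (Y ⊕ Tree P.sig X)
  | Sum.inl y => match e y with
    | Sum.inl z =>
      let w := Function.surjInv (P.surjective Y) z
      ⟨Sum.inl ⟨w.1, w.2.1⟩, fun i => Sum.inl (w.2.2 i)⟩
    | Sum.inr b => (nodeShape P.sig X).map Sum.inr
      (PFunctor.M.dest (F := nodeShape P.sig X) (Function.surjInv hk.surjective b))
  | Sum.inr t => (nodeShape P.sig X).map Sum.inr (PFunctor.M.dest (F := nodeShape P.sig X) t)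

/-- The tree unfolding of a recursive equation. -/
noncomputable def unfolding (hk : IsTreeQuotient P p B θ k) {Y : Type u} (e : Y → F.obj Y ⊕ B.a) :
    Y ⊕ Tree P.sig X → Tree P.sig X :=
  PFunctor.M.corec (hk.unfold e)

theorem dest_unfolding (hk : IsTreeQuotient P p B θ k) {Y : Type u} (e : Y → F.obj Y ⊕ B.a)
    (x : Y ⊕ Tree P.sig X) : PFunctor.M.dest (F := nodeShape P.sig X) (hk.unfolding e x) =
      (nodeShape P.sig X).map (hk.unfolding e) (hk.unfold e x) :=
  PFunctor.M.dest_corec _ _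

theorem unfolding_inr (hk : IsTreeQuotient P p B θ k) {Y : Type u} (e : Y → F.obj Y ⊕ B.a)
    (t : Tree P.sig X) : hk.unfolding e (Sum.inr t) = t := by
  have h1 := PFunctor.M.corec_unique (PFunctor.M.dest (F := nodeShape P.sig X))
    (fun t => hk.unfolding e (Sum.inr t)) fun t => hk.dest_unfolding e (Sum.inr t)
  have h2 := PFunctor.M.corec_unique (PFunctor.M.dest (F := nodeShape P.sig X)) id fun t => rfl
  exact congrFun (h1.trans h2.symm) t

/-- Solutions are unique: by induction on `n`, the cutting at height `n` of a solution is determined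
by the equation. -/
theorem solution_unique (hk : IsTreeQuotient P p B θ k) {Y : Type u} {e : Y → F.obj Y ⊕ B.a}
    {s t : Y → B.a} (hs : IsSolution B e s) (ht : IsSolution B e t) : s = t := by
  obtain ⟨A, η, q, hq⟩ := exists_isFinTreeQuotient P X
  have key : ∀ n, (fun y => hk.trunc q n (s y)) = fun y => hk.trunc q n (t y) := by
    intro n
    induction n with
    | zero => rfl
    | succ n ih =>
      funext y
      rw [hs y, ht y]
      rcases e y with z | b
      · obtain ⟨m, σ, x, rfl⟩ := exists_flat P z
        have ih' := fun i => congrFun ih (x i)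
        simp only [Sum.elim_inl, map_flat, hk.trunc_succ_str hq] at ih' ⊢
        simp only [ih']
      · rfl
  exact funext fun y => hk.eq_of_trunc_eq hq fun n => congrFun (key n) y

theorem exists_isSolution (hk : IsTreeQuotient P p B θ k) {Y : Type u} (e : Y → F.obj Y ⊕ B.a) :
    ∃ s, IsSolution B e s := by
  refine ⟨fun y => k (hk.unfolding e (Sum.inl y)), fun y => ?_⟩
  have hd := hk.dest_unfolding e (Sum.inl y)
  rcases hy : e y with z | b
  · obtain ⟨w, hw⟩ : ∃ w, w = Function.surjInv (P.surjective Y) z := ⟨_, rfl⟩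
    have hz : P.ε.app Y w = z := hw ▸ Function.surjInv_eq (P.surjective Y) z
    have ht : hk.unfolding e (Sum.inl y) =
        Tree.app w.2.1 fun i => hk.unfolding e (Sum.inl (w.2.2 i)) := by
      refine (PFunctor.M.mk_dest (F := nodeShape P.sig X) _).symm.trans ?_
      rw [hd, unfold, hy, hw]
      rfl
    simp only [ht, hk.map_app, Sum.elim_inl, ← hz]
    exact congrArg (fun z => B.str z)
      (map_flat P (fun y => k (hk.unfolding e (Sum.inl y))) w.2.1 w.2.2).symm
  · have ht : hk.unfolding e (Sum.inl y) =
        hk.unfolding e (Sum.inr (Function.surjInv hk.surjective b)) := by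
      rw [← PFunctor.M.mk_dest (F := nodeShape P.sig X) (hk.unfolding e (Sum.inl y)), hd]
      rw [← PFunctor.M.mk_dest (F := nodeShape P.sig X) (hk.unfolding e (Sum.inr _)),
        hk.dest_unfolding]
      rw [unfold, hy]
      rfl
    simp only [ht, unfolding_inr, Sum.elim_inr, id]
    exact Function.surjInv_eq hk.surjective b

theorem isCompletelyIterative (hk : IsTreeQuotient P p B θ k) : IsCompletelyIterative B := by
  intro Y e
  obtain ⟨s, hs⟩ := hk.exists_isSolution e
  exact ⟨s, hs, fun t ht => hk.solution_unique ht hs⟩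

/-- Homomorphisms from `B` to a completely iterative algebra `D` that extend `f : X → D` are the
solutions in `D` of the equation `B ≅ F B + X → F B + D`. -/
theorem isFreeCompletelyIterative (hk : IsTreeQuotient P p B θ k) :
    IsFreeCompletelyIterative B θ where
  completelyIterative := hk.isCompletelyIterative
  universal D hD f := by
    let E := Equiv.ofBijective _ hk.bijective
    have hE : ∀ y, E (E.symm y) = y := E.apply_symm_apply
    have hstr : ∀ z, E.symm (B.str z) = Sum.inl z := fun z => E.symm_apply_apply (Sum.inl z)
    have hθ : ∀ x, E.symm (θ x) = Sum.inr x := fun x => E.symm_apply_apply (Sum.inr x)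
    let e : B.a → F.obj B.a ⊕ D.a := fun y => Sum.map id f (E.symm y)
    obtain ⟨s, hs, huniq⟩ := hD B.a e
    have hs_str : ∀ z, s (B.str z) = D.str (F.map (TypeCat.ofHom s) z) := by
      intro z
      rw [hs, show e (B.str z) = Sum.inl z by simp only [e, hstr, Sum.map_inl, id]]
      rfl
    refine ⟨homOfOp P s fun σ x => ?_, fun x => ?_, fun h hh => hom_ext fun y => ?_⟩
    · rw [hs_str, map_flat]
    · change s (θ x) = f x
      rw [hs, show e (θ x) = Sum.inr (f x) by simp only [e, hθ, Sum.map_inr]]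
      rfl
    · refine congrFun (huniq (fun y => h.f y) fun y => ?_) y
      obtain ⟨z | x, rfl⟩ := E.surjective y
      · simp only [e, E.symm_apply_apply, Sum.map_inl, Sum.elim_inl, id]
        exact hom_str_apply h z
      · simp only [e, E.symm_apply_apply, Sum.map_inr, Sum.elim_inr, id]
        exact hh x

end IsTreeQuotient

theorem exists_isTreeQuotient (P : Presentation F) (p : P.sig.Op 0 ⊕ X) :
    ∃ (B : Endofunctor.Algebra F) (θ : X → B.a) (k : Tree P.sig X → B.a),
      IsTreeQuotient P p B θ k := by
  let r : Setoid (Tree P.sig X) := ⟨SimStar P p, fun s n => Sim.refl _, fun h n => (h n).symm,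
    fun h h' n => (h n).trans (h' n)⟩
  refine ⟨quotientAlgebra P r Tree.app, fun x => Quotient.mk r (Tree.var x), Quotient.mk r,
    fun _ => rfl, fun σ t => (quotientAlgebra_str P r Tree.app ?_ ?_ σ t).symm,
    Quotient.mk_surjective, fun s t => Quotient.eq⟩
  · rintro n σ s t h (_ | m)
    · exact Sim.refl _
    · exact Sim.congr σ _ _ fun i => h i m
  · rintro n m σ τ x y h (_ | l)
    · exact Sim.refl _
    · exact Sim.equation σ τ x y h fun z => cut p l z.out

theorem IsFreeCompletelyIterative.exists_isTreeQuotient (P : Presentation F) (p : P.sig.Op 0 ⊕ X)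
    {B : Endofunctor.Algebra F} {θ : X → B.a} (hB : IsFreeCompletelyIterative B θ) :
    ∃ k : Tree P.sig X → B.a, IsTreeQuotient P p B θ k := by
  obtain ⟨D, ζ, k, hk⟩ := SetFunctor.exists_isTreeQuotient P p
  obtain ⟨h, hh, hbij⟩ := exists_bijective_hom IsCompletelyIterative hk.isCompletelyIterative
    hB.completelyIterative hk.isFreeCompletelyIterative.universal hB.universal
  refine ⟨fun s => h.f (k s), fun x => ?_, fun σ t => ?_, hbij.2.comp hk.surjective, fun s t => ?_⟩
  · rw [hk.map_var, hh]
  · rw [hk.map_app, hom_op]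
  · rw [hbij.1.eq_iff, hk.eq_iff]

/-! ### Cutting on the free algebra and on the free completely iterative algebra -/

section

variable {P : Presentation F} {p : P.sig.Op 0 ⊕ X} {A B : Endofunctor.Algebra F} {η : X → A.a}
  {θ : X → B.a} {q : FinTree P.sig X → A.a} {k : Tree P.sig X → B.a}

theorem IsFinTreeQuotient.hom_eq_toTree (hq : IsFinTreeQuotient P A η q)
    (hk : IsTreeQuotient P p B θ k) {m : A ⟶ B} (hm : ∀ x, m.f (η x) = θ x)
    (s : FinTree P.sig X) : m.f (q s) = k s.toTree := by
  induction s with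
  | var x => rw [hq.map_var, hm, FinTree.toTree, hk.map_var]
  | app σ t ih => simp only [hq.map_app, hom_op, ih, FinTree.toTree, hk.map_app]

theorem IsTreeQuotient.hom_injective (hk : IsTreeQuotient P p B θ k)
    (hq : IsFinTreeQuotient P A η q) {m : A ⟶ B} (hm : ∀ x, m.f (η x) = θ x) :
    Function.Injective m.f := by
  intro x y h
  obtain ⟨s, rfl⟩ := hq.surjective x
  obtain ⟨t, rfl⟩ := hq.surjective y
  rw [hq.hom_eq_toTree hk hm, hq.hom_eq_toTree hk hm, hk.eq_iff, simStar_toTree_iff] at h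
  exact (hq.eq_iff s t).2 h

theorem IsTreeQuotient.trunc_hom (hk : IsTreeQuotient P p B θ k) (hq : IsFinTreeQuotient P A η q)
    {m : A ⟶ B} (hm : ∀ x, m.f (η x) = θ x) (n : ℕ) (s : FinTree P.sig X) :
    hk.trunc q n (m.f (q s)) = q (cut p n s.toTree) := by
  rw [hq.hom_eq_toTree hk hm, hk.trunc_apply hq]

theorem IsTreeQuotient.trunc_hom_trunc (hk : IsTreeQuotient P p B θ k)
    (hq : IsFinTreeQuotient P A η q) {m : A ⟶ B} (hm : ∀ x, m.f (η x) = θ x) (l n : ℕ) (y : B.a) :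
    hk.trunc q l (m.f (hk.trunc q n y)) = hk.trunc q (min l n) y := by
  obtain ⟨t, rfl⟩ := hk.surjective y
  rw [hk.trunc_apply hq, hk.trunc_apply hq, hk.trunc_hom hq hm, cut_cut]

end

end SetFunctor

open SetFunctor

theorem mainTheorem6 (F : Type u ⥤ Type u) [Limits.PreservesFilteredColimits F]
    (X : Type u) [Nonempty X] :
    -- presentations, free algebras and free completely iterative algebras exist
    Nonempty (SetFunctor.Presentation F) ∧
    (∃ (Φ : Endofunctor.Algebra F) (η : X → Φ.a), SetFunctor.IsFreeAlgebra Φ η) ∧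
    (∃ (Ψ : Endofunctor.Algebra F) (η : X → Ψ.a), SetFunctor.IsFreeCompletelyIterative Ψ η) ∧
    ∀ (P : SetFunctor.Presentation F) (p : P.sig.Op 0 ⊕ X)
      (Φ : Endofunctor.Algebra F) (ηΦ : X → Φ.a) (_ : SetFunctor.IsFreeAlgebra Φ ηΦ)
      (Ψ : Endofunctor.Algebra F) (ηΨ : X → Ψ.a) (_ : SetFunctor.IsFreeCompletelyIterative Ψ ηΨ),
      ∃ (q : SetFunctor.FinTree P.sig X → Φ.a) (k : SetFunctor.Tree P.sig X → Ψ.a) (m : Φ ⟶ Ψ)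
        (_ : PartialOrder Φ.a) (_ : PartialOrder Ψ.a),
        -- `Φ` and `Ψ` as quotients of trees, ordered by cutting, and `Φ` as a subposet of `Ψ`
        SetFunctor.IsFinTreeQuotient P Φ ηΦ q ∧
        SetFunctor.IsTreeQuotient P p Ψ ηΨ k ∧
        SetFunctor.IsFinCuttingOrder P p q ∧
        SetFunctor.IsCuttingOrder P p k ∧
        (∀ x, m.f (ηΦ x) = ηΨ x) ∧
        (∀ x y : Φ.a, m.f x ≤ m.f y ↔ x ≤ y) ∧
        -- the common conservative completion
        (∃ (C : Type u) (_ : PartialOrder C) (j : Ψ.a → C),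
          SetFunctor.IsConservativeCompletion j ∧
          SetFunctor.IsConservativeCompletion (fun x => j (m.f x))) ∧
        -- the structure `[φ, η] : F Φ + X → Φ` extends to `[ψ, η] : F Ψ + X → Ψ`
        Function.Bijective (Sum.elim (fun t => Φ.str t) ηΦ) ∧
        Function.Bijective (Sum.elim (fun t => Ψ.str t) ηΨ) ∧
        SetFunctor.IsUniqueContinuousExtension
          (Sum.elim (fun t => Φ.str t) ηΦ) (Sum.elim (fun t => Ψ.str t) ηΨ)
          (Sum.map (fun t => F.map m.f t) id) (fun x => m.f x) ∧
        -- and so does the structure `φ : F Φ → Φ` to `ψ : F Ψ → Ψ`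
        SetFunctor.IsUniqueContinuousExtension
          (fun t => Φ.str t) (fun t => Ψ.str t) (fun t => F.map m.f t) (fun x => m.f x) := by
  obtain ⟨P₀⟩ := nonempty_presentation F
  obtain ⟨x₀⟩ := ‹Nonempty X›
  refine ⟨⟨P₀⟩, ?_, ?_, ?_⟩
  · obtain ⟨A, η, q, hq⟩ := exists_isFinTreeQuotient P₀ X
    exact ⟨A, η, hq.isFreeAlgebra⟩
  · obtain ⟨B, θ, k, hk⟩ := exists_isTreeQuotient P₀ (Sum.inr x₀)
    exact ⟨B, θ, hk.isFreeCompletelyIterative⟩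
  intro P p Φ ηΦ hΦ Ψ ηΨ hΨ
  obtain ⟨q, hq⟩ := hΦ.exists_isFinTreeQuotient P
  obtain ⟨k, hk⟩ := hΨ.exists_isTreeQuotient P p
  obtain ⟨m, hm, -⟩ := hΦ Ψ ηΨ
  have hminj := hk.hom_injective hq hm
  let dΦ : ℕ → Φ.a → Φ.a := fun n x => hk.trunc q n (m.f x)
  let dΨ : ℕ → Ψ.a → Ψ.a := fun n y => m.f (hk.trunc q n y)
  have hddΦ : ∀ l n x, dΦ l (dΦ n x) = dΦ (min l n) x := fun l n x =>
    hk.trunc_hom_trunc hq hm l n (m.f x)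
  have hddΨ : ∀ l n y, dΨ l (dΨ n y) = dΨ (min l n) y := fun l n y =>
    congrArg m.f (hk.trunc_hom_trunc hq hm l n y)
  have hdΦq : ∀ n s, dΦ n (q s) = q (cut p n s.toTree) := hk.trunc_hom hq hm
  have hdΨk : ∀ n t, dΨ n (k t) = k (cut p n t).toTree := fun n t => by
    simp only [dΨ, hk.trunc_apply hq, hq.hom_eq_toTree hk hm]
  let _ : PartialOrder Φ.a := cuttingOrder dΦ hddΦ
  let _ : PartialOrder Ψ.a := cuttingOrder dΨ hddΨ
  have hcΦ : IsCutting dΦ := ⟨hddΦ, fun x y h => hminj (hk.eq_of_trunc_eq hq h), fun _ _ => Iff.rfl⟩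
  have hcΨ : IsCutting dΨ :=
    ⟨hddΨ, fun x y h => hk.eq_of_trunc_eq hq fun n => hminj (h n), fun _ _ => Iff.rfl⟩
  refine ⟨q, k, m, inferInstance, inferInstance, hq, hk, fun s t => ?_, fun s t => ?_, hm,
    fun x y => ?_, ?_, hq.bijective, hk.bijective, ?_, ?_⟩
  · simp only [hcΦ.le_iff, hdΦq, ← hq.eq_iff]
  · simp only [hcΨ.le_iff, hdΨk, ← hk.eq_iff]
  · rw [hcΨ.le_iff, hcΦ.le_iff, hminj.eq_iff]
    simp only [dΦ, dΨ, hminj.eq_iff]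
  · obtain ⟨C, hC, e, j, he, hec, hj, hje, hjr⟩ := hcΨ.exists_cutComplete
    refine ⟨C, hC, j, ?_, ?_⟩
    · exact hcΨ.isConservativeCompletion he hec hj hje fun n c =>
        (hjr n c).imp' (dΨ n) fun _ h => h
    · exact hcΦ.isConservativeCompletion he hec (hj.comp hminj) (fun n x => hje n (m.f x))
        fun n c => (hjr n c).imp' (hk.trunc q n) fun _ h => h
  · have hext : ∀ z, Sum.elim (fun t => Ψ.str t) ηΨ (Sum.map (fun t => F.map m.f t) id z) =
        m.f (Sum.elim (fun t => Φ.str t) ηΦ z) := by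
      rintro (z | x)
      · exact (hom_str_apply m z).symm
      · exact (hm x).symm
    refine hcΨ.isUniqueContinuousExtension hext (fun z n => ?_)
      fun u hu => absurd (hk.bijective.2 u) hu
    obtain ⟨w, hw⟩ := hq.bijective.2 (hk.trunc q (n + 1) (Sum.elim (fun t => Ψ.str t) ηΨ z))
    exact ⟨w, (hext w).trans (congrArg m.f hw)⟩
  · refine hcΨ.isUniqueContinuousExtension (fun z => (hom_str_apply m z).symm) (fun z n => ?_)
      fun u hu n hn => ?_
    · exact ⟨F.map (TypeCat.ofHom (hk.trunc q n)) z,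
        (hom_str_apply m _).symm.trans (congrArg m.f (hk.trunc_succ_str hq n z).symm)⟩
    · -- outside the range of `ψ` there are only variables, which are their own cuttings at all
      -- positive heights
      obtain ⟨t, rfl⟩ := hk.surjective u
      obtain ⟨x, rfl⟩ | ⟨l, σ, s, rfl⟩ := t.exists_eq
      · cases n with
        | zero => rfl
        | succ n =>
          refine absurd hn ?_
          rwa [hdΨk, cut_succ_var]
      · exact absurd ⟨_, (hk.map_app σ s).symm⟩ hu
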